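/- **Theorem (probabilistic completeness of RRdT\*).** *Problem.* Let $d\ge 2$, $C_{obs}\subseteq C\subseteq\mathbb R^d$, let $C_{free}=\overline{C\setminus C_{obs}}$ have finite Lebesgue measure, and let $q_{init},q_{goal}\in C_{free}$. A feasible path is a continuous $\sigma:[0,1]\to C_{free}$ with $\sigma(0)=q_{init}$, $\sigma(1)=q_{goal}$. Assume that the problem is robustly feasible: there are a feasible path $\sigma$ and a $\delta>0$ such that the closed ball of radius $\delta$ around every $\sigma(\tau)$ is contained in $C_{free}$. *Algorithm RRdT\*.* The inputs are $q_{init},q_{goal}$, a step size $\epsilon>0$, a threshold $\eta>0$, a number $k\ge1$ of arms and a node budget $N$. The planner maintains a graph in $C_{free}$, whose connected components are called d-trees (the one containing $q_{init}$ is the root tree), $k$ arms, and a counter $n$. An arm $a$ (local sampler) has a starting point, a history (the sequence of its proposed points, each with reward $1$ if the move was collision free and $0$ otherwise), and a position (its last collision-free proposal, or else its starting point). The scheduler assigns to it a success probability $p(a)\in[0,1]$, a function of its starting point and history, which is discounted: along every infinite sequence of observations $p(a)$ tends to $0$. *Joining* a point $q$ to the d-trees within distance $\epsilon$ means adding, for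 each d-tree that has a node $v$ with $|q-v|\le\epsilon$ and $[v,q]\subseteq C_{free}$, an edge from $q$ to the closest such node of that d-tree. Initially $n=1$, the node $q_{init}$ is the root tree, and $k$ arms are started at independent uniform points of $C_{free}$, each of which is a d-tree of its own. Each iteration of the main loop does the following. 1. If some arm has $p(a)<\eta$, a point $q$ is drawn uniformly from $C_{free}$, added as a node, and joined to all d-trees within distance $\epsilon$. If there are none, $q$ is a new d-tree and a new arm started at $q$ replaces the first such arm $a$. Then $n$ increases by $1$. 2. Otherwise an arm $a$ is picked with probability proportional to $p(a)$. It proposes $q=\mathrm{pos}(a)+\epsilon u$, where $u$ is a unit vector with a von Mises–Fisher distribution whose mean direction and concentration are arbitrary functions of the starting point and history of $a$. If $[\mathrm{pos}(a),q]\subseteq C_{free}$, then $q$ is added as a node and joined to all d-trees within distance $\epsilon$; if this joins it to the root tree, the root tree is rewired; $a$ moves to $q$; and $n$ increases by $1$. In either case the outcome is appended to the history of $a$. *Rewiring* the root tree goes through its nodes $v$ one by one; if a node $u$ within the rewiring radius (an arbitrary function of the number of nodes), with $[u,v]\subseteq C_{free}$, reaches $v$ at the least accumulated path length, and that is strictly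 less than the current cost of $v$, then the edge from the parent of $v$ to $v$ is replaced by the edge $uv$. All random draws are independent. The solution $\sigma_{sol}(i)$ is the path in the root tree from $q_{init}$ to the best node $v$ with $|v-q_{goal}|\le\epsilon$ and $[v,q_{goal}]\subseteq C_{free}$, followed by the segment $[v,q_{goal}]$; there is no solution if there is no such node. *Claim.* As $i\to\infty$, the probability that after $i$ iterations of the main loop the solution $\sigma_{sol}(i)$ exists and is a feasible path (so that it reaches $q_{goal}$) tends to $1$: $$\lim_{i\to\infty}\mathbb P\bigl(\{q_{goal}\in\sigma_{sol}(i)\}\bigr)=1 .$$ Likewise, the probability that the main loop with budget $N$ (run while $n\le N$) ends and returns a feasible path tends to $1$ as $N\to\infty$. -/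

import Mathlib

open Set MeasureTheory ProbabilityTheory Filter Topology
open scoped ENNReal NNReal

noncomputable section

namespace RRdT

open scoped Classical

/-- The ambient Euclidean space of the C-space. -/
abbrev E (d : ℕ) : Type := EuclideanSpace ℝ (Fin d)

/-- The sphere of unit directions. -/
abbrev Dir (d : ℕ) : Type := Metric.sphere (0 : E d) 1

/-! ### The planning problem -/

/-- A feasibility planning problem: C-space, obstacle space, initial and goal configurations. -/
structure Problem (d : ℕ) where
  C : Set (E d)
  obs : Set (E d)
  obs_subset : obs ⊆ C
  init : E d
  goal : E d
  init_mem : init ∈ closure (C \ obs)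
  goal_mem : goal ∈ closure (C \ obs)

/-- The obstacle-free space, the closure of the complement of the obstacle space in `C`. -/
def Problem.free {d : ℕ} (Q : Problem d) : Set (E d) := closure (Q.C \ Q.obs)

/-- A path from the initial to the goal configuration is feasible if it is collision free. -/
def Problem.IsFeasible {d : ℕ} (Q : Problem d) (σ : Path Q.init Q.goal) : Prop :=
  ∀ τ, σ τ ∈ Q.free

/-- The problem has a feasible path with strong clearance: for some `δ > 0`, the closed `δ`-ball
around each point of the path lies in the free space. -/
def Problem.RobustlyFeasible {d : ℕ} (Q : Problem d) : Prop :=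
  ∃ σ : Path Q.init Q.goal, Q.IsFeasible σ ∧
    ∃ δ : ℝ, 0 < δ ∧ ∀ τ, Metric.closedBall (σ τ) δ ⊆ Q.free

/-! ### Local samplers (arms) -/

/-- The von Mises-Fisher distribution with mean direction `m` and concentration `κ`: the
probability measure on the unit sphere with density proportional to `exp (κ ⟪m, u⟫)` with respect
to the surface measure. -/
def vonMisesFisher {d : ℕ} (m : Dir d) (κ : ℝ≥0) : Measure (Dir d) :=
  let ν := ((volume : Measure (E d)).toSphere).withDensity
    (fun u => ENNReal.ofReal (Real.exp ((κ : ℝ) * inner ℝ (m : E d) (u : E d))))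
  (ν univ)⁻¹ • ν

/-- A local sampler: where it was started, and what it has observed since, that is, the list
(newest first) of its proposed points, each with its reward (`true` if the move was collision
free). -/
structure Arm (d : ℕ) where
  start : E d
  obs : List (E d × Bool)

/-- The current position of an arm: its last successful proposal, or else its starting point. -/
def Arm.pos {d : ℕ} (a : Arm d) : E d :=
  match a.obs.find? (fun o => o.2) with
  | some o => o.1
  | none => a.start

/-- The inputs of the planner. -/
structure Params (d : ℕ) where
  /-- step size / connection distance -/
  ε : ℝ
  ε_pos : 0 < ε
  /-- restart threshold for the success probability of an arm -/
  η : ℝ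
  η_pos : 0 < η
  /-- the success probability that the scheduler assigns to an arm, computed from its history -/
  prob : Arm d → unitInterval
  /-- mean direction of the proposal distribution of an arm, adapted to its history -/
  meanDir : Arm d → Dir d
  /-- concentration of the proposal distribution of an arm, adapted to its history -/
  conc : Arm d → ℝ≥0
  /-- a procedure that turns a uniform random number into a von Mises-Fisher direction -/
  draw : Dir d → ℝ≥0 → unitInterval → Dir d
  draw_measurable : Measurable (fun x : Dir d × ℝ≥0 × unitInterval => draw x.1 x.2.1 x.2.2)
  draw_law : ∀ m κ, Measure.map (draw m κ) (volume : Measure unitInterval) = vonMisesFisher m κ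
  /-- radius of the neighbourhoods used for rewiring, as a function of the number of nodes -/
  radius : ℕ → ℝ

/-- The scheduler discounts: along every infinite sequence of observations of an arm, however
successful, the probability assigned to the arm decays to zero. -/
def Params.Discounting {d : ℕ} (P : Params d) : Prop :=
  ∀ (q : E d) (o : ℕ → E d × Bool),
    Tendsto (fun m => P.prob ⟨q, ((List.range m).map o).reverse⟩) atTop (𝓝 0)

/-! ### Trees: joining and rewiring -/

/-- The nodes from which `q` can be reached by a collision-free segment of length at most `r`. -/
def near {d : ℕ} (F : Set (E d)) (r : ℝ) (verts : List (E d)) (q : E d) : List (E d) :=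
  verts.filter (fun v => dist q v ≤ r ∧ segment ℝ v q ⊆ F)

/-- The nodes that `q` is joined to: in each d-tree (connected component of `G`) that has nodes
near `q`, the closest of them. -/
def joinPoints {d : ℕ} (F : Set (E d)) (r : ℝ) (verts : List (E d)) (G : SimpleGraph (E d))
    (q : E d) : List (E d) :=
  (near F r verts q).filter (fun v =>
    ((near F r verts q).filter (fun w => G.Reachable v w)).argmin (fun w => dist q w) = some v)

/-- The graph after joining `q` to all d-trees within distance `r`. -/
def join {d : ℕ} (F : Set (E d)) (r : ℝ) (verts : List (E d)) (G : SimpleGraph (E d))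
    (q : E d) : SimpleGraph (E d) :=
  G ⊔ SimpleGraph.fromEdgeSet {e | ∃ v ∈ joinPoints F r verts G q, e = s(q, v)}

/-- Euclidean length of a walk. -/
def walkLength {d : ℕ} {G : SimpleGraph (E d)} {a b : E d} (p : G.Walk a b) : ℝ≥0∞ :=
  (p.darts.map (fun e => edist e.fst e.snd)).sum

/-- The accumulated cost of reaching `b` from `a` in `G` (infinite if not connected). -/
def cost {d : ℕ} (G : SimpleGraph (E d)) (a b : E d) : ℝ≥0∞ := ⨅ p : G.Walk a b, walkLength p

/-- Rewire one node `v` of the tree of `root`: let `u` be the neighbourhood node through which `v`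
is reached from the root at the least accumulated cost, and `p` the current parent of `v`; if going
through `u` is strictly cheaper, then the edge `p v` is replaced by the edge `u v`. -/
def rewireAt {d : ℕ} (F : Set (E d)) (r : ℝ) (verts : List (E d)) (root : E d)
    (G : SimpleGraph (E d)) (v : E d) : SimpleGraph (E d) :=
  if G.Reachable root v then
    match (near F r verts v).argmin (fun u => cost G root u + edist u v),
      (verts.filter (fun p => G.Adj p v)).argmin (fun p => cost G root p + edist p v) with
    | some u, some p =>
      if cost G root u + edist u v < cost G root v then
        G.deleteEdges {s(p, v)} ⊔ SimpleGraph.edge u v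
      else G
    | _, _ => G
  else G

/-- Rewire the whole tree of `root`, node by node. -/
def rewire {d : ℕ} (F : Set (E d)) (r : ℝ) (verts : List (E d)) (root : E d)
    (G : SimpleGraph (E d)) : SimpleGraph (E d) :=
  verts.foldl (rewireAt F r verts root) G

/-! ### The planner -/

/-- The state of the planner: the nodes and edges of all d-trees (the d-trees are the connected
components of `graph` on the nodes, the root tree is the one that contains the initial
configuration), the arms, the number of calls made to the global sampler, and the counter `n`. -/
structure State (d k : ℕ) where
  verts : List (E d)
  graph : SimpleGraph (E d)
  arms : Fin k → Arm d
  calls : ℕ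
  count : ℕ

/-- Multinomial choice of an arm with weights `w`, from a uniform random number `x`. -/
def pickArm {k : ℕ} [NeZero k] (w : Fin k → ℝ) (x : ℝ) : Fin k :=
  ((List.finRange k).find? (fun i => x * ∑ j, w j ≤ ∑ j ∈ Finset.Iic i, w j)).getD 0

/-- Initial state: the root tree, and `k` arms at uniform samples, each a d-tree of its own. -/
def initState {d : ℕ} (k : ℕ) (Q : Problem d) (U : ℕ → E d) : State d k where
  verts := List.ofFn (fun i : Fin k => U i) ++ [Q.init]
  graph := ⊥
  arms := fun i => ⟨U i, []⟩
  calls := k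
  count := 1

/-- One iteration of the main loop. If some arm has probability below `η`, a global sample is
joined to all d-trees within distance `ε`; if there are none, it becomes a new d-tree, with a new
arm that replaces the expired one. Otherwise an arm is picked, it makes a step of length `ε` in a
random direction, and, if the step is collision free, the new point is joined to all d-trees within
distance `ε`, the root tree is rewired if the new point has joined it, and the arm moves there.
`U` is the stream of global samples, `z` the randomness for picking an arm and for its step. -/
def step {d k : ℕ} [NeZero k] (Q : Problem d) (P : Params d) (U : ℕ → E d) (z : unitInterval × unitInterval)
    (s : State d k) : State d k :=
  match (List.finRange k).find? (fun i => (P.prob (s.arms i) : ℝ) < P.η) with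
  | some i =>
    let q := U s.calls
    { verts := q :: s.verts
      graph := join Q.free P.ε s.verts s.graph q
      arms := if joinPoints Q.free P.ε s.verts s.graph q = [] then
          Function.update s.arms i ⟨q, []⟩
        else s.arms
      calls := s.calls + 1
      count := s.count + 1 }
  | none =>
    let i := pickArm (fun j => (P.prob (s.arms j) : ℝ)) (z.1 : ℝ)
    let a := s.arms i
    let q : E d := a.pos + P.ε • (P.draw (P.meanDir a) (P.conc a) z.2 : E d)
    if segment ℝ a.pos q ⊆ Q.free then
      let G := join Q.free P.ε s.verts s.graph q
      let verts := q :: s.verts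
      { verts := verts
        graph := if G.Reachable Q.init q then
            rewire Q.free (P.radius verts.length) verts Q.init G
          else G
        arms := Function.update s.arms i ⟨a.start, (q, true) :: a.obs⟩
        calls := s.calls
        count := s.count + 1 }
    else
      { s with arms := Function.update s.arms i ⟨a.start, (q, false) :: a.obs⟩ }

/-- The state of the planner after `t` iterations of the main loop. -/
def run {d : ℕ} (k : ℕ) [NeZero k] (Q : Problem d) (P : Params d) (U : ℕ → E d)
    (Z : ℕ → unitInterval × unitInterval) : ℕ → State d k
  | 0 => initState k Q U
  | t + 1 => step Q P U (Z t) (run k Q P U Z t)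

/-- The piecewise linear path along a walk. -/
def walkPath {d : ℕ} {G : SimpleGraph (E d)} : {a b : E d} → G.Walk a b → Path a b
  | a, _, .nil => Path.refl a
  | a, _, .cons (v := c) _ p => (Path.segment a c).trans (walkPath p)

/-- The node of the root tree through which the goal is reached at the least cost by a
collision-free segment of length at most `ε`, if there is one. -/
def goalParent {d k : ℕ} (Q : Problem d) (P : Params d) (s : State d k) : Option (E d) :=
  ((near Q.free P.ε s.verts Q.goal).filter (fun v => s.graph.Reachable Q.init v)).argmin
    (fun v => cost s.graph Q.init v + edist v Q.goal)

/-- The solution that the planner returns in state `s`: the path in the root tree from the initial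
configuration to a node to which the goal can be joined, and then the segment to the goal; `none`
if the goal cannot be joined to the root tree. -/
def solution {d k : ℕ} (Q : Problem d) (P : Params d) (s : State d k) :
    Option (Path Q.init Q.goal) :=
  match goalParent Q P s with
  | some v =>
    if h : s.graph.Reachable Q.init v then
      some ((walkPath h.exists_isPath.choose).trans (Path.segment v Q.goal))
    else none
  | none => none

/-- The solution returned for the node budget `N`: the one found when the main loop ends, that is,
when the counter first exceeds `N`; `none` if the loop never ends. -/
def returned {d : ℕ} (k : ℕ) [NeZero k] (Q : Problem d) (P : Params d) (U : ℕ → E d)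
    (Z : ℕ → unitInterval × unitInterval) (N : ℕ) : Option (Path Q.init Q.goal) :=
  if h : ∃ t, N < (run k Q P U Z t).count then
    solution Q P (run k Q P U Z (Nat.find h))
  else none

/-! ### Randomness -/

/-- `U` is the sequence of outcomes of the calls to the global sampler, independent and uniform on
`F`; `Z` are the random numbers used in the iterations of the main loop for picking an arm and for
its local step, independent and uniform on the unit square; the two are independent. -/
structure IsRandomSource {d : ℕ} {Ω : Type*} [MeasurableSpace Ω] (μ : Measure Ω) (F : Set (E d))
    (U : ℕ → Ω → E d) (Z : ℕ → Ω → unitInterval × unitInterval) : Prop where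
  measurable_U : ∀ j, Measurable (U j)
  measurable_Z : ∀ t, Measurable (Z t)
  uniform_U : ∀ j, pdf.IsUniform (U j) F μ volume
  uniform_Z : ∀ t, μ.map (Z t) = volume
  indep_U : iIndepFun U μ
  indep_Z : iIndepFun Z μ
  indep_UZ : IndepFun (fun ω j => U j ω) (fun ω t => Z t ω) μ

end RRdT

end

/-!
The global sampler alone already makes the planner complete; nothing is needed about the local
samplers except that they expire.

* Discounting forces calls of the global sampler along every run, whatever the random draws are
  (`RRdT.tendsto_calls`): without such calls the arms would never be replaced, one of them would
  make infinitely many observations, and its success probability would fall below the threshold.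
* Connectivity is never lost. A join only adds edges, and when rewiring replaces the parent of a
  node `v`, both the old and the new parent are strictly cheaper to reach than `v`, hence reachable
  without passing through `v` (`RRdT.IsRoadmap.reachable_rewireAt`). As a join connects a new point
  to all nodes near it, every sample drawn in the main loop stays in the same d-tree as each node
  within distance `ε` by a collision-free segment (`RRdT.Invariant`).
* The clearance gives small balls along a feasible path such that points chosen from consecutive
  balls are within `ε` of each other by a collision-free segment
  (`RRdT.Problem.RobustlyFeasible.exists_balls`). By the second Borel-Cantelli lemma, almost surely
  every ball is hit by infinitely many of the independent uniform samples
  (`RRdT.ae_frequently_mem`). Once one sample after the first `k` has been drawn in each ball, in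
  whatever order, they link the root tree to the goal (`RRdT.exists_solution_of_frequently`).

So almost surely there is a feasible solution in all but finitely many states. The scheduler and
the proposal parameters are arbitrary functions, so the events in question need not be measurable;
outer measure is continuous along increasing sequences of arbitrary sets, which is enough to pass to
the limit (`RRdT.tendsto_measure_of_ae_eventually`). For the version with a node budget `N`, the
counter grows by at most one per iteration, so the loop ends after at least `N` iterations.
-/

namespace RRdT

open scoped Classical

/-! ### Joining and rewiring preserve connectivity -/

section Graph

variable {d : ℕ} {F : Set (E d)} {r : ℝ} {verts : List (E d)} {G : SimpleGraph (E d)}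

lemma mem_near {q v : E d} :
    v ∈ near F r verts q ↔ v ∈ verts ∧ dist q v ≤ r ∧ segment ℝ v q ⊆ F := by
  simp [near]

lemma near_of_mem_joinPoints {q v : E d} (h : v ∈ joinPoints F r verts G q) :
    v ∈ near F r verts q :=
  (List.mem_filter.1 h).1

lemma le_join (q : E d) : G ≤ join F r verts G q := le_sup_left

/-- Although `q` is joined only to the closest node of a d-tree, this connects it to every node
from which it can be reached. -/
lemma reachable_join {q w : E d} (hw : w ∈ near F r verts q) :
    (join F r verts G q).Reachable q w := by
  have hne : (near F r verts q).filter (fun x => G.Reachable w x) ≠ [] :=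
    List.ne_nil_of_mem (List.mem_filter.2 ⟨hw, by simp⟩)
  obtain ⟨v, hv⟩ := Option.ne_none_iff_exists'.1
    (mt (List.argmin_eq_none (f := fun x => dist q x)).1 hne)
  obtain ⟨hvn, hwv⟩ := List.mem_filter.1 (List.argmin_mem hv)
  have hwv : G.Reachable w v := by simpa using hwv
  -- `v` and `w` lie in the same d-tree, so the minimization that defines `joinPoints` at `v` is
  -- the one over the d-tree of `w`.
  have hcomp : (near F r verts q).filter (fun x => G.Reachable v x)
      = (near F r verts q).filter (fun x => G.Reachable w x) :=
    List.filter_congr fun x _ => by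
      simpa using ⟨fun h => hwv.trans h, fun h => hwv.symm.trans h⟩
  have hvj : v ∈ joinPoints F r verts G q :=
    List.mem_filter.2 ⟨hvn, by rw [hcomp]; simpa using hv⟩
  have hqv : (join F r verts G q).Reachable q v := by
    by_cases hqv : q = v
    · rw [hqv]
    · refine SimpleGraph.Adj.reachable (Or.inr ?_)
      rw [SimpleGraph.fromEdgeSet_adj]
      exact ⟨⟨v, hvj, rfl⟩, hqv⟩
  exact hqv.trans (hwv.symm.mono (le_join q))

lemma walkLength_append {a b c : E d} (p : G.Walk a b) (q : G.Walk b c) :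
    walkLength (p.append q) = walkLength p + walkLength q := by
  simp [walkLength, SimpleGraph.Walk.darts_append]

lemma cost_self (a : E d) : cost G a a = 0 :=
  le_antisymm (iInf_le_of_le SimpleGraph.Walk.nil (by simp [walkLength])) bot_le

lemma cost_le_walkLength_of_mem_support {a b v : E d} (p : G.Walk a b) (h : v ∈ p.support) :
    cost G a v ≤ walkLength p := by
  rw [← p.take_spec h, walkLength_append]
  exact (iInf_le _ _).trans le_self_add

/-- A node that is strictly cheaper to reach than `v` is still reachable when an edge at `v` is
removed, since a cheap walk to it avoids `v`. -/
lemma reachable_deleteEdges_of_cost_lt {a b p v : E d} (h : cost G a b < cost G a v) :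
    (G.deleteEdges {s(p, v)}).Reachable a b := by
  obtain ⟨w, hw⟩ := iInf_lt_iff.1 h
  refine ⟨w.toDeleteEdge _ fun he => ?_⟩
  exact (cost_le_walkLength_of_mem_support w
    (w.snd_mem_support_of_mem_edges he)).not_gt hw

lemma exists_adj_cost_add_le {a v : E d} (w : G.Walk a v) (h : a ≠ v) :
    ∃ p, G.Adj p v ∧ cost G a p + edist p v ≤ walkLength w := by
  cases w using SimpleGraph.Walk.concatRec with
  | Hnil => exact absurd rfl h
  | Hconcat w' hadj =>
    refine ⟨_, hadj, ?_⟩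
    rw [SimpleGraph.Walk.concat_eq_append, walkLength_append]
    exact add_le_add (iInf_le _ _) (by simp [walkLength])

/-- The edges of `G` join listed nodes by segments in `F`. -/
def IsRoadmap (F : Set (E d)) (verts : List (E d)) (G : SimpleGraph (E d)) : Prop :=
  ∀ a b, G.Adj a b → a ∈ verts ∧ segment ℝ a b ⊆ F

lemma IsRoadmap.join (hG : IsRoadmap F verts G) (q : E d) :
    IsRoadmap F (q :: verts) (join F r verts G q) := by
  rintro a b (hab | hab)
  · exact ⟨List.mem_cons_of_mem _ (hG a b hab).1, (hG a b hab).2⟩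
  · rw [SimpleGraph.fromEdgeSet_adj] at hab
    obtain ⟨⟨v, hv, he⟩, -⟩ := hab
    obtain ⟨hmem, -, hs⟩ := mem_near.1 (near_of_mem_joinPoints hv)
    rcases Sym2.eq_iff.1 he with ⟨rfl, rfl⟩ | ⟨rfl, rfl⟩
    · exact ⟨List.mem_cons_self, by rwa [segment_symm]⟩
    · exact ⟨List.mem_cons_of_mem _ hmem, hs⟩

lemma IsRoadmap.rewireAt (hG : IsRoadmap F verts G) (root : E d) {v : E d} (hv : v ∈ verts) :
    IsRoadmap F verts (rewireAt F r verts root G v) := by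
  unfold RRdT.rewireAt
  split_ifs with h
  swap
  · exact hG
  split
  swap
  · exact hG
  rename_i u p hu hp
  split_ifs with hc
  swap
  · exact hG
  obtain ⟨huv, -, hs⟩ := mem_near.1 (List.argmin_mem hu)
  rintro a b (hab | hab)
  · exact hG a b (SimpleGraph.deleteEdges_le _ hab)
  · rw [SimpleGraph.edge_adj] at hab
    rcases hab.1 with ⟨rfl, rfl⟩ | ⟨rfl, rfl⟩
    · exact ⟨huv, hs⟩
    · exact ⟨hv, by rwa [segment_symm]⟩

/-- Rewiring a node does not disconnect anything. The new parent `u` and the old parent `p` of `v`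
are both strictly cheaper than `v`, so they are reached from the root without passing through `v`,
and the edge from `p` to `v` that is removed can be replaced by a detour through the root. -/
lemma IsRoadmap.reachable_rewireAt (hG : IsRoadmap F verts G) (root v : E d) {a b : E d}
    (hab : G.Reachable a b) : (RRdT.rewireAt F r verts root G v).Reachable a b := by
  unfold RRdT.rewireAt
  split_ifs with h
  swap
  · exact hab
  split
  swap
  · exact hab
  rename_i u p hu hp
  split_ifs with hc
  swap
  · exact hab
  set G' := G.deleteEdges {s(p, v)} ⊔ SimpleGraph.edge u v with hG'
  have hne : root ≠ v := by
    rintro rfl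
    rw [cost_self] at hc
    exact not_lt_bot hc
  have hroot_u : G'.Reachable root u :=
    (reachable_deleteEdges_of_cost_lt (le_self_add.trans_lt hc)).mono le_sup_left
  have huv : u ≠ v := by
    rintro rfl
    exact (le_self_add.trans_lt hc).false
  have hroot_v : G'.Reachable root v :=
    hroot_u.trans (SimpleGraph.Adj.reachable (Or.inr (by simp [SimpleGraph.edge_adj, huv])))
  have hpv : G.Adj p v := by simpa using (List.mem_filter.1 (List.argmin_mem hp)).2
  have hp_le : cost G root p + edist p v ≤ cost G root v := by
    refine le_iInf fun w => ?_
    obtain ⟨p', hp', hle⟩ := exists_adj_cost_add_le w hne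
    exact (List.le_of_mem_argmin (f := fun x => cost G root x + edist x v)
      (List.mem_filter.2 ⟨(hG p' v hp').1, by simpa using hp'⟩) hp).trans hle
  have hp_top : cost G root p ≠ ∞ := by
    have hv_top : cost G root v ≠ ∞ := by
      obtain ⟨w⟩ := h
      refine ne_top_of_le_ne_top ?_ (iInf_le _ w)
      unfold walkLength
      generalize w.darts = l
      induction l with
      | nil => simp
      | cons e l ih => simpa [edist_ne_top] using ih
    exact ne_top_of_le_ne_top hv_top (le_self_add.trans hp_le)
  have hp_lt : cost G root p < cost G root v :=
    (ENNReal.lt_add_right hp_top (edist_pos.2 hpv.ne).ne').trans_le hp_le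
  have hroot_p : G'.Reachable root p :=
    (reachable_deleteEdges_of_cost_lt hp_lt).mono le_sup_left
  have hedge : ∀ x y, G.Adj x y → G'.Reachable x y := by
    intro x y hxy
    by_cases he : s(x, y) = s(p, v)
    · rcases Sym2.eq_iff.1 he with ⟨rfl, rfl⟩ | ⟨rfl, rfl⟩
      · exact hroot_p.symm.trans hroot_v
      · exact hroot_v.symm.trans hroot_p
    · refine SimpleGraph.Adj.reachable (Or.inl ?_)
      rw [SimpleGraph.deleteEdges_adj]
      exact ⟨hxy, he⟩
  obtain ⟨w⟩ := hab
  induction w with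
  | nil => rfl
  | cons hxy _ ih => exact (hedge _ _ hxy).trans ih

lemma IsRoadmap.foldl_rewireAt (root : E d) (l : List (E d)) :
    ∀ {G : SimpleGraph (E d)}, IsRoadmap F verts G → (∀ v ∈ l, v ∈ verts) →
      IsRoadmap F verts (l.foldl (RRdT.rewireAt F r verts root) G) ∧
      ∀ a b, G.Reachable a b → (l.foldl (RRdT.rewireAt F r verts root) G).Reachable a b := by
  induction l with
  | nil => exact fun hG _ => ⟨hG, fun _ _ h => h⟩
  | cons v l ih =>
    intro G hG hl
    obtain ⟨h₁, h₂⟩ := ih (hG.rewireAt (r := r) root (hl v List.mem_cons_self))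
      fun x hx => hl x (List.mem_cons_of_mem _ hx)
    exact ⟨h₁, fun a b hab => h₂ a b (hG.reachable_rewireAt root v hab)⟩

lemma IsRoadmap.rewire (hG : IsRoadmap F verts G) (root : E d) :
    IsRoadmap F verts (RRdT.rewire F r verts root G) :=
  (IsRoadmap.foldl_rewireAt root verts hG fun _ h => h).1

lemma IsRoadmap.reachable_rewire (hG : IsRoadmap F verts G) (root : E d) {a b : E d}
    (hab : G.Reachable a b) : (RRdT.rewire F r verts root G).Reachable a b :=
  (IsRoadmap.foldl_rewireAt root verts hG fun _ h => h).2 a b hab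

end Graph

/-! ### The invariant of the main loop -/

section Invariant

variable {d k : ℕ} {Q : Problem d} {P : Params d} {U : ℕ → E d}
  {Z : ℕ → unitInterval × unitInterval} {z : unitInterval × unitInterval} {s : State d k}

/-- What holds in every state: the edges are collision free, and every global sample that has been
drawn in the main loop is in the same d-tree as each node within distance `ε` by a collision-free
segment. The first `k` samples are excepted: they start the arms and are not joined to anything. -/
structure Invariant (Q : Problem d) (P : Params d) (U : ℕ → E d) (s : State d k) : Prop where
  init_mem : Q.init ∈ s.verts
  roadmap : IsRoadmap Q.free s.verts s.graph
  sample_mem : ∀ j, k ≤ j → j < s.calls → U j ∈ s.verts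
  reachable : ∀ j, k ≤ j → j < s.calls → ∀ w ∈ s.verts, dist (U j) w ≤ P.ε →
    segment ℝ w (U j) ⊆ Q.free → s.graph.Reachable (U j) w

lemma invariant_initState : Invariant Q P U (initState k Q U) where
  init_mem := by simp [initState]
  roadmap := fun _ _ h => h.elim
  sample_mem := fun _ h₁ h₂ => absurd h₂ h₁.not_gt
  reachable := fun _ h₁ h₂ => absurd h₂ h₁.not_gt

/-- After `q` is joined, the old samples are still connected to the nodes near them, now including
`q`. -/
lemma Invariant.reachable_join (hs : Invariant Q P U s) {q : E d} {j : ℕ} (hkj : k ≤ j)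
    (hj : j < s.calls) {w : E d} (hw : w ∈ q :: s.verts) (hd : dist (U j) w ≤ P.ε)
    (hseg : segment ℝ w (U j) ⊆ Q.free) :
    (join Q.free P.ε s.verts s.graph q).Reachable (U j) w := by
  rcases List.mem_cons.1 hw with rfl | hw
  · exact (RRdT.reachable_join (mem_near.2 ⟨hs.sample_mem j hkj hj, by rwa [dist_comm],
      by rwa [segment_symm]⟩)).symm
  · exact (hs.reachable j hkj hj w hw hd hseg).mono (le_join q)

lemma Invariant.step [NeZero k] (hs : Invariant Q P U s) : Invariant Q P U (step Q P U z s) := by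
  unfold RRdT.step
  split
  · constructor
    · exact List.mem_cons_of_mem _ hs.init_mem
    · exact hs.roadmap.join _
    · intro j hkj hj
      rcases Nat.lt_succ_iff_lt_or_eq.1 hj with hj | rfl
      · exact List.mem_cons_of_mem _ (hs.sample_mem j hkj hj)
      · exact List.mem_cons_self
    · intro j hkj hj w hw hd hseg
      rcases Nat.lt_succ_iff_lt_or_eq.1 hj with hj | rfl
      · exact hs.reachable_join hkj hj hw hd hseg
      · rcases List.mem_cons.1 hw with rfl | hw
        · rfl
        · exact RRdT.reachable_join (mem_near.2 ⟨hw, hd, hseg⟩)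
  · dsimp only
    split_ifs with hfree hroot
    · constructor
      · exact List.mem_cons_of_mem _ hs.init_mem
      · exact (hs.roadmap.join _).rewire _
      · exact fun j hkj hj => List.mem_cons_of_mem _ (hs.sample_mem j hkj hj)
      · exact fun j hkj hj w hw hd hseg => (hs.roadmap.join _).reachable_rewire _
          (hs.reachable_join hkj hj hw hd hseg)
    · constructor
      · exact List.mem_cons_of_mem _ hs.init_mem
      · exact hs.roadmap.join _
      · exact fun j hkj hj => List.mem_cons_of_mem _ (hs.sample_mem j hkj hj)
      · exact fun j hkj hj w hw hd hseg => hs.reachable_join hkj hj hw hd hseg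
    · exact ⟨hs.init_mem, hs.roadmap, hs.sample_mem, hs.reachable⟩

lemma invariant_run [NeZero k] (t : ℕ) : Invariant Q P U (run k Q P U Z t) := by
  induction t with
  | zero => exact invariant_initState
  | succ t ih => exact ih.step

end Invariant

/-! ### The solution is feasible once the goal is near the root tree -/

section Solution

variable {d k : ℕ} {Q : Problem d} {P : Params d} {s : State d k}

lemma range_walkPath_subset {F : Set (E d)} {verts : List (E d)} {G : SimpleGraph (E d)}
    (hG : IsRoadmap F verts G) {a b : E d} (p : G.Walk a b) (ha : a ∈ F) :
    range (walkPath p) ⊆ F := by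
  induction p with
  | nil => simpa [walkPath] using ha
  | cons h p ih =>
    have hseg := (hG _ _ h).2
    rw [walkPath, Path.trans_range, Path.range_segment]
    exact union_subset hseg (ih (hseg (right_mem_segment ℝ _ _)))

lemma exists_solution_of_reachable (hG : IsRoadmap Q.free s.verts s.graph) {v : E d}
    (hv : v ∈ near Q.free P.ε s.verts Q.goal) (hreach : s.graph.Reachable Q.init v) :
    ∃ σ : Path Q.init Q.goal, solution Q P s = some σ ∧ Q.IsFeasible σ := by
  have hne : (near Q.free P.ε s.verts Q.goal).filter (fun v => s.graph.Reachable Q.init v) ≠ [] :=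
    List.ne_nil_of_mem (List.mem_filter.2 ⟨hv, by simpa using hreach⟩)
  obtain ⟨w, hw⟩ := Option.ne_none_iff_exists'.1
    (mt (List.argmin_eq_none (f := fun v => cost s.graph Q.init v + edist v Q.goal)).1 hne)
  obtain ⟨hwn, hwr⟩ := List.mem_filter.1 (List.argmin_mem hw)
  have hwr : s.graph.Reachable Q.init w := by simpa using hwr
  have hgp : goalParent Q P s = some w := hw
  refine ⟨_, by rw [solution, hgp]; exact dif_pos hwr, fun τ => ?_⟩
  have hrange := Path.trans_range (walkPath hwr.exists_isPath.choose) (Path.segment w Q.goal)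
  have hτ := mem_range_self (f := (walkPath hwr.exists_isPath.choose).trans
    (Path.segment w Q.goal)) τ
  rw [hrange, Path.range_segment] at hτ
  exact hτ.elim (fun h => range_walkPath_subset hG _ Q.init_mem h) fun h => (mem_near.1 hwn).2.2 h

end Solution

/-! ### The global sampler is called infinitely often -/

section Calls

variable {d k : ℕ} [NeZero k] {Q : Problem d} {P : Params d} {U : ℕ → E d}
  {Z : ℕ → unitInterval × unitInterval} {z : unitInterval × unitInterval} {s : State d k}

lemma calls_le_step : s.calls ≤ (step Q P U z s).calls := by
  unfold step
  split
  · exact Nat.le_succ _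
  · dsimp only
    split_ifs <;> exact le_rfl

lemma calls_run_mono : Monotone fun t => (run k Q P U Z t).calls :=
  monotone_nat_of_le_succ fun _ => calls_le_step

lemma count_step_le : (step Q P U z s).count ≤ s.count + 1 := by
  unfold step
  split
  · exact le_rfl
  · dsimp only
    split_ifs <;> simp

lemma calls_step_add_count_le :
    (step Q P U z s).calls + s.count ≤ s.calls + (step Q P U z s).count := by
  unfold step
  split
  · exact (by omega : s.calls + 1 + s.count ≤ s.calls + (s.count + 1))
  · dsimp only
    split_ifs <;> simp

lemma count_run_le (t : ℕ) : (run k Q P U Z t).count ≤ t + 1 := by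
  induction t with
  | zero => exact le_rfl
  | succ t ih => exact count_step_le.trans (Nat.succ_le_succ ih)

lemma calls_run_le (t : ℕ) : (run k Q P U Z t).calls ≤ k + (run k Q P U Z t).count := by
  induction t with
  | zero => exact Nat.le_succ k
  | succ t ih =>
    have h := calls_step_add_count_le (Q := Q) (P := P) (U := U) (z := Z t)
      (s := run k Q P U Z t)
    change (step Q P U (Z t) (run k Q P U Z t)).calls ≤
      k + (step Q P U (Z t) (run k Q P U Z t)).count
    omega

/-- In an iteration without a call of the global sampler no arm has expired, and exactly one of the
arms makes an observation. -/
lemma arms_step_of_calls_eq (h : (step Q P U z s).calls = s.calls) :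
    (∀ i, P.η ≤ P.prob (s.arms i)) ∧ ∃ i x,
      (step Q P U z s).arms = Function.update s.arms i ⟨(s.arms i).start, x :: (s.arms i).obs⟩ := by
  unfold step at h ⊢
  split at h
  · exact absurd h (Nat.succ_ne_self _)
  · rename_i hfind
    refine ⟨fun i => ?_, ?_⟩
    · simpa using List.find?_eq_none.1 hfind i (List.mem_finRange i)
    · dsimp only
      split_ifs
      · exact ⟨_, _, rfl⟩
      · exact ⟨_, _, rfl⟩
      · exact ⟨_, _, rfl⟩

/-- Histories of one arm that grow without bound are the initial parts of one infinite sequence of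
observations. -/
lemma exists_seq_of_growing {α : Type*} [Inhabited α] {l : ℕ → List α}
    (hmono : ∀ t, l t <:+ l (t + 1)) (hunb : ∀ B, ∃ t, B ≤ (l t).length) :
    ∃ o : ℕ → α, ∀ t, ((List.range (l t).length).map o).reverse = l t := by
  have hsuff : ∀ {t t'}, t ≤ t' → l t <:+ l t' := fun {t t'} h => by
    induction h with
    | refl => exact List.suffix_refl _
    | step _ ih => exact ih.trans (hmono _)
  choose τ hτ using hunb
  refine ⟨fun m => (l (τ (m + 1))).reverse.getD m default, fun t => ?_⟩
  rw [List.reverse_eq_iff]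
  refine List.ext_getElem (by simp) fun m h₁ h₂ => ?_
  have hm : m < (l (τ (m + 1))).reverse.length := by
    rw [List.length_reverse]
    exact hτ (m + 1)
  rw [List.getElem_map, List.getElem_range, List.getD_eq_getElem _ _ hm]
  rcases le_total t (τ (m + 1)) with h | h
  · exact ((List.reverse_prefix.2 (hsuff h)).getElem h₂).symm
  · exact (List.reverse_prefix.2 (hsuff h)).getElem hm

/-- Discounting forces calls of the global sampler along every run. Otherwise the arms are never
replaced from some time on, and one of them makes infinitely many observations, so its success
probability drops below the threshold. -/
lemma tendsto_calls (hP : P.Discounting) :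
    Tendsto (fun t => (run k Q P U Z t).calls) atTop atTop := by
  refine tendsto_atTop_atTop_of_monotone calls_run_mono fun B => ?_
  by_contra! hB
  -- A bounded monotone sequence of natural numbers is eventually constant.
  obtain ⟨T, hT⟩ : ∃ T, ∀ t, (run k Q P U Z (T + t)).calls = (run k Q P U Z T).calls := by
    have hbdd : BddAbove (range fun t => (run k Q P U Z t).calls) :=
      ⟨B, by rintro _ ⟨t, rfl⟩; exact (hB t).le⟩
    obtain ⟨T, hT⟩ := Nat.sSup_mem (range_nonempty _) hbdd
    refine ⟨T, fun t => le_antisymm ?_ (calls_run_mono (Nat.le_add_right T t))⟩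
    dsimp only at hT
    rw [hT]
    exact le_csSup hbdd (mem_range_self (T + t))
  set S : ℕ → State d k := fun t => run k Q P U Z (T + t) with hS
  have hstep : ∀ t, (∀ i, P.η ≤ P.prob ((S t).arms i)) ∧ ∃ i x, (S (t + 1)).arms =
      Function.update (S t).arms i ⟨((S t).arms i).start, x :: ((S t).arms i).obs⟩ := fun t =>
    arms_step_of_calls_eq (U := U) (z := Z (T + t)) ((hT (t + 1)).trans (hT t).symm)
  have harm : ∀ i t, ((S (t + 1)).arms i).start = ((S t).arms i).start ∧
      ((S t).arms i).obs <:+ ((S (t + 1)).arms i).obs := by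
    intro i t
    obtain ⟨j, x, hj⟩ := (hstep t).2
    rw [hj]
    by_cases hij : i = j
    · subst hij
      simp
    · simp [Function.update_of_ne hij]
  have hstart : ∀ i t, ((S t).arms i).start = ((S 0).arms i).start := fun i t => by
    induction t with
    | zero => rfl
    | succ t ih => exact (harm i t).1.trans ih
  have htotal : ∀ t, t ≤ ∑ i, ((S t).arms i).obs.length := by
    intro t
    induction t with
    | zero => exact Nat.zero_le _
    | succ t ih =>
      refine Nat.succ_le_of_lt (ih.trans_lt (Finset.sum_lt_sum
        (fun i _ => (harm i t).2.length_le) ?_))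
      obtain ⟨j, x, hj⟩ := (hstep t).2
      exact ⟨j, Finset.mem_univ j, by simp [hj]⟩
  obtain ⟨i, hi⟩ : ∃ i, ∀ B, ∃ t, B ≤ ((S t).arms i).obs.length := by
    by_contra! h
    choose b hb using h
    exact (htotal (∑ i, b i)).not_gt (Finset.sum_lt_sum_of_nonempty Finset.univ_nonempty
      fun i _ => hb i _)
  have : Inhabited (E d × Bool) := ⟨(0, true)⟩
  obtain ⟨o, ho⟩ := exists_seq_of_growing (l := fun t => ((S t).arms i).obs)
    (fun t => (harm i t).2) hi
  have hlim : Tendsto (fun m => (P.prob ⟨((S 0).arms i).start,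
      ((List.range m).map o).reverse⟩ : ℝ)) atTop (𝓝 0) :=
    (continuous_subtype_val.tendsto _).comp (hP _ o)
  obtain ⟨M, hM⟩ := eventually_atTop.1 (hlim.eventually_lt_const P.η_pos)
  obtain ⟨t, ht⟩ := hi M
  have hlt := hM _ ht
  rw [ho t, ← hstart i t] at hlt
  exact ((hstep t).1 i).not_gt hlt

end Calls

/-! ### Chains of samples along the path -/

section Chain

variable {d : ℕ} {Q : Problem d} {U : ℕ → E d}

/-- Along a path with clearance there are balls, the first around the initial configuration and
the `M`-th around the goal, such that points chosen from them form a chain of collision-free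
segments of length at most `ε`. -/
lemma Problem.RobustlyFeasible.exists_balls (hQ : Q.RobustlyFeasible) {ε : ℝ} (hε : 0 < ε) :
    ∃ (c : ℕ → E d) (ρ : ℝ) (M : ℕ), 0 < ρ ∧ (∀ n, Metric.ball (c n) ρ ⊆ Q.free) ∧
      c 0 = Q.init ∧ c M = Q.goal ∧
      (∀ n, ∀ x ∈ Metric.ball (c n) ρ, dist x (c n) ≤ ε ∧ segment ℝ (c n) x ⊆ Q.free) ∧
      ∀ n, ∀ x ∈ Metric.ball (c n) ρ, ∀ y ∈ Metric.ball (c (n + 1)) ρ,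
        dist x y ≤ ε ∧ segment ℝ x y ⊆ Q.free := by
  obtain ⟨σ, -, δ, hδ, hσ⟩ := hQ
  -- Two centres of consecutive balls are less than `2 * ρ` apart, so two such points are less than
  -- `4 * ρ` apart, and both lie within `4 * ρ` of the first centre.
  obtain ⟨ρ, hρ, hρε, hρδ⟩ : ∃ ρ : ℝ, 0 < ρ ∧ 4 * ρ ≤ ε ∧ 4 * ρ ≤ δ :=
    ⟨min ε δ / 4, by positivity, by linarith [min_le_left ε δ], by linarith [min_le_right ε δ]⟩
  obtain ⟨t, ht0, hmono, ⟨M, hM⟩, hcov⟩ := exists_monotone_Icc_subset_open_cover_unitInterval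
    (c := fun τ : unitInterval => σ ⁻¹' Metric.ball (σ τ) ρ)
    (fun τ => Metric.isOpen_ball.preimage σ.continuous)
    (fun τ _ => mem_iUnion.2 ⟨τ, Metric.mem_ball_self hρ⟩)
  have hconsec : ∀ n, dist (σ (t n)) (σ (t (n + 1))) < 2 * ρ := fun n => by
    obtain ⟨τ, hτ⟩ := hcov n
    have hle : t n ≤ t (n + 1) := hmono (Nat.le_succ n)
    have h₁ : dist (σ (t n)) (σ τ) < ρ := hτ (left_mem_Icc.2 hle)
    have h₂ : dist (σ (t (n + 1))) (σ τ) < ρ := hτ (right_mem_Icc.2 hle)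
    linarith [dist_triangle_right (σ (t n)) (σ (t (n + 1))) (σ τ)]
  have hfree : ∀ n, Metric.ball (σ (t n)) (4 * ρ) ⊆ Q.free := fun n =>
    (Metric.ball_subset_ball hρδ).trans (Metric.ball_subset_closedBall.trans (hσ (t n)))
  have hsub : ∀ n, Metric.ball (σ (t n)) ρ ⊆ Metric.ball (σ (t n)) (4 * ρ) := fun n =>
    Metric.ball_subset_ball (by linarith)
  refine ⟨fun n => σ (t n), ρ, M, hρ, fun n => (hsub n).trans (hfree n), by simp [ht0],
    by simp [hM M le_rfl], fun n x hx => ⟨?_, ?_⟩, fun n x hx y hy => ⟨?_, ?_⟩⟩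
  · linarith [Metric.mem_ball.1 hx]
  · exact ((convex_ball _ _).segment_subset (Metric.mem_ball_self (by linarith))
      (hsub n hx)).trans (hfree n)
  · have hx' := Metric.mem_ball.1 hx
    have hy' := Metric.mem_ball'.1 hy
    linarith [hconsec n, dist_triangle4 x (σ (t n)) (σ (t (n + 1))) y]
  · refine ((convex_ball _ _).segment_subset (hsub n hx) ?_).trans (hfree n)
    have hy' := Metric.mem_ball.1 hy
    refine Metric.mem_ball.2 ?_
    linarith [hconsec n, dist_triangle_right y (σ (t n)) (σ (t (n + 1))),
      dist_triangle y (σ (t (n + 1))) (σ (t n)), dist_comm (σ (t n)) (σ (t (n + 1)))]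

/-- If infinitely many samples fall into each ball, then in all states with sufficiently many calls
of the global sampler the planner has a feasible solution. -/
lemma exists_solution_of_frequently (P : Params d) (k : ℕ)
    {c : ℕ → E d} {ρ : ℝ} {M : ℕ} (hc0 : c 0 = Q.init) (hcM : c M = Q.goal)
    (hcenter : ∀ n, ∀ x ∈ Metric.ball (c n) ρ, dist x (c n) ≤ P.ε ∧
      segment ℝ (c n) x ⊆ Q.free)
    (hchain : ∀ n, ∀ x ∈ Metric.ball (c n) ρ, ∀ y ∈ Metric.ball (c (n + 1)) ρ,
      dist x y ≤ P.ε ∧ segment ℝ x y ⊆ Q.free)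
    (hU : ∀ n, ∃ᶠ j in atTop, U j ∈ Metric.ball (c n) ρ) :
    ∃ m, ∀ s : State d k, Invariant Q P U s → m ≤ s.calls →
      ∃ σ : Path Q.init Q.goal, solution Q P s = some σ ∧ Q.IsFeasible σ := by
  choose j hkj hj using fun n => frequently_atTop.1 (hU n) k
  refine ⟨∑ n ∈ Finset.range (M + 1), (j n + 1), fun s hs hm => ?_⟩
  have hcalls : ∀ n ≤ M, j n < s.calls := fun n hn =>
    (Nat.lt_of_succ_le (Finset.single_le_sum (f := fun n => j n + 1) (fun _ _ => Nat.zero_le _)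
      (Finset.mem_range.2 (Nat.lt_succ_of_le hn)))).trans_le hm
  have hreach : ∀ n ≤ M, s.graph.Reachable Q.init (U (j n)) := by
    intro n
    induction n with
    | zero =>
      intro h
      obtain ⟨h₁, h₂⟩ := hcenter 0 _ (hj 0)
      rw [hc0] at h₁ h₂
      exact (hs.reachable _ (hkj 0) (hcalls 0 h) _ hs.init_mem h₁ h₂).symm
    | succ n ih =>
      intro h
      have hn : n ≤ M := (Nat.le_succ n).trans h
      obtain ⟨h₁, h₂⟩ := hchain n _ (hj n) _ (hj (n + 1))
      exact (ih hn).trans (hs.reachable _ (hkj _) (hcalls _ hn) _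
        (hs.sample_mem _ (hkj _) (hcalls _ h)) h₁ (by rwa [segment_symm]))
  obtain ⟨h₁, h₂⟩ := hcenter M _ (hj M)
  rw [hcM] at h₁ h₂
  exact exists_solution_of_reachable hs.roadmap (mem_near.2
    ⟨hs.sample_mem _ (hkj M) (hcalls M le_rfl), by rwa [dist_comm], by rwa [segment_symm]⟩)
    (hreach M le_rfl)

end Chain

/-! ### Uniform samples hit every ball infinitely often -/

section Probability

variable {Ω : Type*} [MeasurableSpace Ω] {μ : Measure Ω} [IsProbabilityMeasure μ]

lemma ae_frequently_mem {d : ℕ} {F B : Set (E d)} {U : ℕ → Ω → E d}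
    (hF : IsClosed F) (hvol : volume F ≠ ∞) (hB : MeasurableSet B) (hBF : B ⊆ F)
    (hB0 : volume B ≠ 0) (hU : ∀ j, Measurable (U j))
    (hunif : ∀ j, pdf.IsUniform (U j) F μ volume) (hindep : iIndepFun U μ) :
    ∀ᵐ ω ∂μ, ∃ᶠ j in atTop, U j ω ∈ B := by
  have hmeas : ∀ j, MeasurableSet (U j ⁻¹' B) := fun j => hU j hB
  have hprob : ∀ j, μ (U j ⁻¹' B) = (volume F)⁻¹ * volume B := fun j => by
    have h : μ.map (U j) B = (volume[|F]) B := by rw [hunif j]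
    rwa [Measure.map_apply (hU j) hB, cond_apply hF.measurableSet,
      inter_eq_self_of_subset_right hBF] at h
  have hset : iIndepSet (fun j => U j ⁻¹' B) μ :=
    (iIndepSet_iff_meas_biInter hmeas).2 fun S =>
      hindep.measure_inter_preimage_eq_mul S (sets := fun _ => B) fun _ _ => hB
  have hsum : ∑' j, μ (U j ⁻¹' B) = ∞ := by
    simp_rw [hprob]
    exact ENNReal.tsum_const_eq_top_of_ne_zero
      (mul_ne_zero (ENNReal.inv_ne_zero.2 hvol) hB0)
  have hone := measure_limsup_eq_one hmeas hset hsum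
  have hae : ∀ᵐ ω ∂μ, ω ∈ limsup (fun j => U j ⁻¹' B) atTop :=
    (prob_compl_eq_zero_iff (MeasurableSet.measurableSet_limsup hmeas)).2 hone
  filter_upwards [hae] with ω hω
  exact mem_limsup_iff_frequently_mem.1 hω

/-- Events that almost surely hold from some time on have probabilities tending to one. The events
need not be measurable: outer measure is continuous along increasing sequences of arbitrary sets. -/
lemma tendsto_measure_of_ae_eventually {p : ℕ → Ω → Prop}
    (h : ∀ᵐ ω ∂μ, ∀ᶠ i in atTop, p i ω) :
    Tendsto (fun i => μ {ω | p i ω}) atTop (𝓝 1) := by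
  have hmono : Monotone fun n => {ω | ∀ i ≥ n, p i ω} :=
    fun _ _ hnm _ hω i hi => hω i (hnm.trans hi)
  have hunion : μ (⋃ n, {ω | ∀ i ≥ n, p i ω}) = 1 := by
    rw [← measure_univ (μ := μ)]
    refine measure_congr (eventuallyEq_univ.2 ?_)
    filter_upwards [h] with ω hω
    exact mem_iUnion.2 (eventually_atTop.1 hω)
  have hlim := tendsto_measure_iUnion_atTop (μ := μ) hmono
  rw [hunion] at hlim
  exact tendsto_of_tendsto_of_tendsto_of_le_of_le hlim tendsto_const_nhds
    (fun n => measure_mono fun ω hω => hω n le_rfl) fun _ => prob_le_one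

end Probability

end RRdT

theorem mainTheorem2 {d : ℕ} (hd : 2 ≤ d) (Q : RRdT.Problem d)
    (hvol : volume Q.free ≠ ∞) (hQ : Q.RobustlyFeasible)
    (k : ℕ) [NeZero k] (P : RRdT.Params d) (hP : P.Discounting)
    {Ω : Type*} [MeasurableSpace Ω] (μ : Measure Ω) [IsProbabilityMeasure μ]
    (U : ℕ → Ω → RRdT.E d) (Z : ℕ → Ω → unitInterval × unitInterval)
    (hUZ : RRdT.IsRandomSource μ Q.free U Z) :
    Tendsto (fun i : ℕ => μ {ω | ∃ σ : Path Q.init Q.goal,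
        RRdT.solution Q P (RRdT.run k Q P (fun j => U j ω) (fun t => Z t ω) i) = some σ ∧
        Q.IsFeasible σ}) atTop (𝓝 1) ∧
    Tendsto (fun N : ℕ => μ {ω | ∃ σ : Path Q.init Q.goal,
        RRdT.returned k Q P (fun j => U j ω) (fun t => Z t ω) N = some σ ∧
        Q.IsFeasible σ}) atTop (𝓝 1) := by
  obtain ⟨c, ρ, M, hρ, hball, hc0, hcM, hcenter, hchain⟩ := hQ.exists_balls P.ε_pos
  have hhit : ∀ᵐ ω ∂μ, ∀ n, ∃ᶠ j in atTop, U j ω ∈ Metric.ball (c n) ρ :=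
    ae_all_iff.2 fun n => RRdT.ae_frequently_mem isClosed_closure hvol measurableSet_ball
      (hball n) (Metric.measure_ball_pos volume _ hρ).ne' hUZ.measurable_U hUZ.uniform_U
      hUZ.indep_U
  constructor
  · refine RRdT.tendsto_measure_of_ae_eventually ?_
    filter_upwards [hhit] with ω hω
    obtain ⟨m, hm⟩ := RRdT.exists_solution_of_frequently P k hc0 hcM hcenter hchain hω
    filter_upwards [(RRdT.tendsto_calls (k := k) hP).eventually_ge_atTop m] with i hi
    exact hm _ (RRdT.invariant_run i) hi
  · refine RRdT.tendsto_measure_of_ae_eventually ?_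
    filter_upwards [hhit] with ω hω
    obtain ⟨m, hm⟩ := RRdT.exists_solution_of_frequently P k hc0 hcM hcenter hchain hω
    have hcalls := RRdT.tendsto_calls (k := k) (Q := Q) (U := fun j => U j ω)
      (Z := fun t => Z t ω) hP
    filter_upwards [hcalls.eventually_ge_atTop m] with N hN
    have hend : ∃ t, N < (RRdT.run k Q P (fun j => U j ω) (fun t => Z t ω) t).count := by
      obtain ⟨t, ht⟩ := (hcalls.eventually_ge_atTop (k + N + 1)).exists
      have hle := RRdT.calls_run_le (k := k) (Q := Q) (P := P) (U := fun j => U j ω)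
        (Z := fun t => Z t ω) t
      exact ⟨t, by omega⟩
    -- The counter grows by at most one per iteration, so the budget `N` allows `N` iterations.
    have hNt : N ≤ Nat.find hend :=
      Nat.le_of_lt_succ ((Nat.find_spec hend).trans_le (RRdT.count_run_le _))
    rw [RRdT.returned, dif_pos hend]
    exact hm _ (RRdT.invariant_run _) (hN.trans (RRdT.calls_run_mono hNt))
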